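/- Let $K\ge 2$ and let $\mathbb F_q$ be a finite field. There are $K$ messages $W_1,\dots,W_K\in\mathbb F_q^L$ with i.i.d. uniform symbols, and $K$ non-colluding databases $D_1,\dots,D_K$ on a cycle: $D_n$ stores exactly $Z_n=\{W_n,W_{n+1}\}$, with $W_{K+1}=W_1$ (for $K=2$ both databases store both messages). A retrieval scheme of length $L\ge 1$ consists, for every desired index $k$, of queries $Q_1^{[k]},\dots,Q_K^{[k]}$ that are jointly independent of $(W_1,\dots,W_K)$, and of discrete answers $A_n^{[k]}$, each of which is (almost surely) a deterministic function of $Q_n^{[k]}$ and $Z_n$. The scheme is private if for every $n$ the joint law of $(Q_n^{[k]},A_n^{[k]},W_1,\dots,W_K)$ does not depend on $k$, and reliable if for every $k$ the message $W_k$ is almost surely a function of all the queries $Q_{1}^{[k]},\dots,Q_K^{[k]}$ and answers $A_{1}^{[k]},\dots,A_K^{[k]}$. The rate of a private reliable scheme is $L/\sum_{n=1}^{K}H(A_n^{[k]})$, where $H$ is Shannon entropy in base $q$ (by privacy it does not depend on $k$). The PIR capacity $C_{\mathrm{PIR}}$ is the supremum of the rates of all private reliable schemes, over all $L\ge 1$.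 Then $$C_{\mathrm{PIR}}=\frac{2}{K+1}.$$ -/

import Mathlib

open MeasureTheory ProbabilityTheory
open scoped ENNReal

/-- Shannon entropy, in base `q`, of a discrete random variable `X` with countably many values,
as an element of `[0, ∞]`. -/
noncomputable def shannonEntropy {Ω α : Type} [MeasurableSpace Ω]
    (q : ℕ) (P : Measure Ω) (X : Ω → α) : ℝ≥0∞ :=
  ∑' a, ENNReal.ofReal (Real.negMulLog (P.real (X ⁻¹' {a})) / Real.log q)

/-- A retrieval strategy for `K` messages, each a vector of `L` symbols of the finite field `F`,
stored in `N` databases, where database `n` holds exactly the messages `W m` with `m ∈ Z n`.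
Messages, queries and answers are random variables on one probability space `Ω`. The superscript
`k` of `Q k n`, `A k n` is the index of the desired message. -/
structure PIRScheme (F : Type) [Fintype F] [MeasurableSpace F] {K N : ℕ}
    (Z : Fin N → Finset (Fin K)) (L : ℕ) where
  /-- sample space -/
  Ω : Type
  [measurableSpaceΩ : MeasurableSpace Ω]
  /-- probability measure on the sample space -/
  P : Measure Ω
  [isProbabilityMeasure : IsProbabilityMeasure P]
  /-- query alphabet of each database: any measurable space -/
  Query : Fin N → Type
  [measurableSpaceQuery : ∀ n, MeasurableSpace (Query n)]
  /-- answer alphabet of each database: any countable discrete space -/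
  Answer : Fin N → Type
  [measurableSpaceAnswer : ∀ n, MeasurableSpace (Answer n)]
  [countableAnswer : ∀ n, Countable (Answer n)]
  [discreteAnswer : ∀ n, DiscreteMeasurableSpace (Answer n)]
  /-- the messages: `W ω m` is the `m`-th message -/
  W : Ω → Fin K → Fin L → F
  /-- `Q k n` is the query sent to database `n` when message `k` is desired -/
  Q : Fin K → (n : Fin N) → Ω → Query n
  /-- `A k n` is the answer of database `n` when message `k` is desired -/
  A : Fin K → (n : Fin N) → Ω → Answer n
  measurable_W : Measurable W
  measurable_Q : ∀ k n, Measurable (Q k n)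
  measurable_A : ∀ k n, Measurable (A k n)
  /-- the `K * L` message symbols are i.i.d. uniform on `F` -/
  uniform_W : ∀ w : Fin K → Fin L → F,
    P (W ⁻¹' {w}) = ((Fintype.card F : ℝ≥0∞) ^ (K * L))⁻¹
  /-- the queries are independent of the messages -/
  indep : ∀ k, IndepFun W (fun ω n => Q k n ω) P
  /-- each answer is a deterministic function of the received query and the stored contents -/
  answer_deterministic : ∀ k n, ∃ f : Query n × (Z n → Fin L → F) → Answer n,
    Measurable f ∧ ∀ᵐ ω ∂P, A k n ω = f (Q k n ω, fun m => W ω m)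

attribute [instance] PIRScheme.measurableSpaceΩ PIRScheme.isProbabilityMeasure
  PIRScheme.measurableSpaceQuery PIRScheme.measurableSpaceAnswer
  PIRScheme.countableAnswer PIRScheme.discreteAnswer

namespace PIRScheme

variable {F : Type} [Fintype F] [MeasurableSpace F] {K N : ℕ}
  {Z : Fin N → Finset (Fin K)} {L : ℕ}

/-- Privacy: for each database the joint law of query, answer and messages does not depend on
the desired message. -/
def IsPrivate (S : PIRScheme F Z L) : Prop :=
  ∀ (n : Fin N) (i j : Fin K),
    S.P.map (fun ω => (S.Q i n ω, S.A i n ω, S.W ω)) =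
      S.P.map (fun ω => (S.Q j n ω, S.A j n ω, S.W ω))

/-- Reliability: the desired message is almost surely recovered from all the queries and
answers. -/
def IsReliable (S : PIRScheme F Z L) : Prop :=
  ∀ k : Fin K, ∃ dec : ((n : Fin N) → S.Query n) × ((n : Fin N) → S.Answer n) → Fin L → F,
    Measurable dec ∧ ∀ᵐ ω ∂S.P, dec (fun n => S.Q k n ω, fun n => S.A k n ω) = S.W ω k

/-- Retrieval rate: message length divided by the total entropy of the answers, measured in
`|F|`-ary symbols, when message `k` is desired. (For private schemes it does not depend
on `k`.) -/
noncomputable def rate (S : PIRScheme F Z L) (k : Fin K) : ℝ≥0∞ :=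
  (L : ℝ≥0∞) / ∑ n, shannonEntropy (Fintype.card F) S.P (S.A k n)

end PIRScheme

/-- PIR capacity of a storage system: the supremum of the rates of all private and reliable
schemes, over all positive message lengths. -/
noncomputable def pirCapacity (F : Type) [Fintype F] [MeasurableSpace F] {K N : ℕ}
    (Z : Fin N → Finset (Fin K)) : ℝ≥0∞ :=
  sSup {r | ∃ L : ℕ, 0 < L ∧ ∃ S : PIRScheme F Z L, S.IsPrivate ∧ S.IsReliable ∧
    ∃ k : Fin K, r = S.rate k}

/-- The cyclic graph storage system: `K` databases, database `n` stores the messages `n` and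
`n + 1` (cyclically, `finRotate K` being `n ↦ n + 1` modulo `K`). -/
def cyclicStorage (K : ℕ) : Fin K → Finset (Fin K) :=
  fun n => {n, finRotate K n}

/-! Converse. By privacy the answering functions may be chosen independently of the desired index,
so fixing the realised queries makes the answers deterministic functions G_n of uniform messages,
which jointly determine W_k. Write h_m(X) for the entropy of X given all messages but W_m. Revealing
the messages around the cycle, starting from W_k, bounds the joint entropy of the answers below by
H(W_k) + Σ_{m≠k} h_m(G_m), because G_m involves only W_m and a neighbour already revealed. The
opposite direction gives the same with G_{m-1}. Adding the two (`two_mul_log_card_add_le`) makes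
h_m(G_m) + h_m(G_{m-1}) appear for every m ≠ k. The mean of each term depends only on the law of one
query, so by privacy it may be computed with m desired; there the pair carries all of W_m, since no
other database stores it (`log_card_le_entropyGivenOthers_incident`). Averaging over the queries
gives 2L + (K-1)L ≤ 2 Σ H(A_n).

Achievability. Database n answers b W_n - b' W_{n+1} for selection bits that stay constant around
the cycle from k, except for one flip at a uniformly random database. The sum of the answers
telescopes to ±W_k (`sum_cyclicAnswer`). Whatever k is, a database sees a uniform bit followed by a
flipped copy with probability 1/K. The answer vanishes on (false, false), so it is nonzero with
probability at most (K+1)/(2K). Its entropy is at most that fraction of L plus a constant, and the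
rate tends to at least 2/(K+1) as L grows. -/

/-! ### Entropy on a finite uniform space, and its submodularity. -/

section UniformEntropy

open Finset

variable {Ω α β γ δ : Type*} [Fintype Ω]

open Classical in
/-- The number of points of `Ω` that `X` does not distinguish from `w`. -/
noncomputable def fiberCard (X : Ω → α) (w : Ω) : ℕ := #{v | X v = X w}

/-- The entropy (in nats) of a function of a uniformly distributed point of `Ω`. -/
noncomputable def uniformEntropy (X : Ω → α) : ℝ :=
  (∑ w, (Real.log (Fintype.card Ω) - Real.log (fiberCard X w))) / Fintype.card Ω

lemma fiberCard_pos (X : Ω → α) (w : Ω) : 0 < fiberCard X w :=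
  Finset.card_pos.2 ⟨w, by simp⟩

lemma fiberCard_le_card (X : Ω → α) (w : Ω) : fiberCard X w ≤ Fintype.card Ω :=
  Finset.card_le_univ _

lemma fiberCard_congr {X : Ω → α} {v w : Ω} (h : X v = X w) : fiberCard X v = fiberCard X w := by
  unfold fiberCard
  congr 1
  ext u
  simp [h]

lemma fiberCard_mono {X : Ω → α} {Y : Ω → β} (h : ∀ v w, X v = X w → Y v = Y w) (w : Ω) :
    fiberCard X w ≤ fiberCard Y w := by
  classical
  refine Finset.card_le_card fun v hv => ?_
  simp only [mem_filter, mem_univ, true_and] at hv ⊢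
  exact h v w hv

lemma uniformEntropy_nonneg (X : Ω → α) : 0 ≤ uniformEntropy X := by
  refine div_nonneg (sum_nonneg fun w _ => sub_nonneg.2 ?_) (Nat.cast_nonneg _)
  exact Real.log_le_log (by exact_mod_cast fiberCard_pos X w)
    (by exact_mod_cast fiberCard_le_card X w)

/-- A function of `X` has at most the entropy of `X`. -/
lemma uniformEntropy_mono {X : Ω → α} {Y : Ω → β} (h : ∀ v w, X v = X w → Y v = Y w) :
    uniformEntropy Y ≤ uniformEntropy X := by
  refine div_le_div_of_nonneg_right (sum_le_sum fun w _ => sub_le_sub_left ?_ _)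
    (Nat.cast_nonneg _)
  exact Real.log_le_log (by exact_mod_cast fiberCard_pos X w)
    (by exact_mod_cast fiberCard_mono h w)

lemma uniformEntropy_of_fiberCard_eq [Nonempty Ω] {X : Ω → α} {c : ℕ}
    (h : ∀ w, fiberCard X w = c) :
    uniformEntropy X = Real.log (Fintype.card Ω) - Real.log c := by
  have : (Fintype.card Ω : ℝ) ≠ 0 := by exact_mod_cast Fintype.card_ne_zero
  simp only [uniformEntropy, h, sum_const, card_univ, nsmul_eq_mul]
  field_simp

lemma uniformEntropy_of_injective [Nonempty Ω] {X : Ω → α} (h : Function.Injective X) :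
    uniformEntropy X = Real.log (Fintype.card Ω) := by
  rw [uniformEntropy_of_fiberCard_eq (c := 1)]
  · simp
  · intro w
    exact card_eq_one.2 ⟨w, by ext; simp [h.eq_iff]⟩

lemma uniformEntropy_const (a : α) : uniformEntropy (fun _ : Ω => a) = 0 := by
  simp [uniformEntropy, fiberCard]

/-- Expand the numerator as a count of pairs (u, v) and sum over w first. The w compatible with a
given pair are empty or one fibre of (A, B), which cancels its own cardinality and leaves the
inverse size of a C-fibre containing both u and v. -/
lemma sum_fiberCard_ratio_le {A : Ω → α} {B : Ω → β} {C : Ω → γ}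
    (hA : ∀ v w, A v = A w → C v = C w) (hB : ∀ v w, B v = B w → C v = C w) :
    ∑ w, (fiberCard A w * fiberCard B w : ℝ) /
      (fiberCard C w * fiberCard (fun v => (A v, B v)) w) ≤ Fintype.card Ω := by
  classical
  set d := fiberCard (fun v => (A v, B v)) with hd
  have expand : ∀ w, (fiberCard A w * fiberCard B w : ℝ) / (fiberCard C w * d w) =
      ∑ u, ∑ v, if A u = A w ∧ B v = B w then ((fiberCard C w * d w : ℝ))⁻¹ else 0 := by
    intro w
    have h1 : (fiberCard A w : ℝ) = ∑ u, if A u = A w then 1 else 0 := by simp [fiberCard]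
    have h2 : (fiberCard B w : ℝ) = ∑ u, if B u = B w then 1 else 0 := by simp [fiberCard]
    rw [h1, h2, sum_mul_sum, div_eq_mul_inv, sum_mul]
    refine sum_congr rfl fun u _ => ?_
    rw [sum_mul]
    refine sum_congr rfl fun v _ => ?_
    by_cases hu : A u = A w <;> by_cases hv : B v = B w <;> simp [hu, hv]
  have inner : ∀ u v, (∑ w, if A u = A w ∧ B v = B w then ((fiberCard C w * d w : ℝ))⁻¹ else 0) ≤
      if C v = C u then (fiberCard C u : ℝ)⁻¹ else 0 := by
    intro u v
    by_cases hex : ∃ w₀, A u = A w₀ ∧ B v = B w₀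
    · obtain ⟨w₀, hu, hv⟩ := hex
      have hCu : C u = C w₀ := hA _ _ hu
      have hCv : C v = C w₀ := hB _ _ hv
      rw [if_pos (hCv.trans hCu.symm), hu, hv, ← sum_filter]
      have hset : (univ.filter fun w => A w₀ = A w ∧ B w₀ = B w) =
          univ.filter fun w => (fun v => (A v, B v)) w = (fun v => (A v, B v)) w₀ := by
        ext w; simp [eq_comm]
      rw [sum_congr rfl (g := fun _ => ((fiberCard C u * d w₀ : ℝ))⁻¹), sum_const, hset]
      · have hpos : (d w₀ : ℝ) ≠ 0 := by exact_mod_cast (fiberCard_pos _ _).ne'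
        have hcard : #(univ.filter fun w =>
          (fun v => (A v, B v)) w = (fun v => (A v, B v)) w₀) = d w₀ := by
          rw [hd]; unfold fiberCard; congr
        rw [hcard, nsmul_eq_mul, mul_inv, mul_comm, mul_assoc, inv_mul_cancel₀ hpos, mul_one]
      · intro w hw
        simp only [mem_filter, mem_univ, true_and] at hw
        rw [fiberCard_congr (X := C) (hCu.trans (hA _ _ hw.1)), hd,
          fiberCard_congr (X := fun v => (A v, B v)) (v := w) (w := w₀)
            (Prod.ext hw.1.symm hw.2.symm)]
    · rw [sum_eq_zero]
      · split_ifs <;> positivity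
      · exact fun w _ => if_neg fun h => hex ⟨w, h⟩
  calc _ = ∑ w, ∑ u, ∑ v, if A u = A w ∧ B v = B w
          then ((fiberCard C w * d w : ℝ))⁻¹ else 0 := sum_congr rfl fun w _ => expand w
    _ = ∑ u, ∑ v, ∑ w, if A u = A w ∧ B v = B w
          then ((fiberCard C w * d w : ℝ))⁻¹ else 0 := by
        rw [sum_comm]; exact sum_congr rfl fun u _ => sum_comm
    _ ≤ ∑ u, ∑ v, if C v = C u then (fiberCard C u : ℝ)⁻¹ else 0 :=
        sum_le_sum fun u _ => sum_le_sum fun v _ => inner u v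
    _ = ∑ u : Ω, 1 := by
        refine sum_congr rfl fun u _ => ?_
        have hpos : (fiberCard C u : ℝ) ≠ 0 := by exact_mod_cast (fiberCard_pos _ _).ne'
        rw [← sum_filter, sum_const, nsmul_eq_mul]
        exact mul_inv_cancel₀ hpos
    _ = _ := by simp

/-- Conditional mutual information is nonnegative: apply log x ≤ x - 1 to the ratios, whose mean is
at most 1. -/
lemma uniformEntropy_prod_submodular {A : Ω → α} {B : Ω → β} {C : Ω → γ}
    (hA : ∀ v w, A v = A w → C v = C w) (hB : ∀ v w, B v = B w → C v = C w) :
    uniformEntropy (fun w => (A w, B w)) + uniformEntropy C ≤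
      uniformEntropy A + uniformEntropy B := by
  unfold uniformEntropy
  rw [← add_div, ← add_div, ← sum_add_distrib, ← sum_add_distrib]
  refine div_le_div_of_nonneg_right ?_ (Nat.cast_nonneg _)
  have key : ∀ w, Real.log (fiberCard A w) + Real.log (fiberCard B w) -
      Real.log (fiberCard C w) - Real.log (fiberCard (fun v => (A v, B v)) w) ≤
      (fiberCard A w * fiberCard B w : ℝ) /
        (fiberCard C w * fiberCard (fun v => (A v, B v)) w) - 1 := by
    intro w
    have h1 : (0 : ℝ) < fiberCard A w := by exact_mod_cast fiberCard_pos _ _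
    have h2 : (0 : ℝ) < fiberCard B w := by exact_mod_cast fiberCard_pos _ _
    have h3 : (0 : ℝ) < fiberCard C w := by exact_mod_cast fiberCard_pos _ _
    have h4 : (0 : ℝ) < fiberCard (fun v => (A v, B v)) w := by exact_mod_cast fiberCard_pos _ _
    have := Real.log_le_sub_one_of_pos (div_pos (mul_pos h1 h2) (mul_pos h3 h4))
    rw [Real.log_div (mul_pos h1 h2).ne' (mul_pos h3 h4).ne', Real.log_mul h1.ne' h2.ne',
      Real.log_mul h3.ne' h4.ne'] at this
    linarith
  have hsum := (sum_le_sum fun w (_ : w ∈ (univ : Finset Ω)) => key w)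
  have hratio := sum_fiberCard_ratio_le hA hB
  simp only [sum_sub_distrib, sum_add_distrib, sum_const, card_univ, nsmul_eq_mul, mul_one]
    at hsum ⊢
  linarith

/-- Submodularity of entropy: here `A` and `B` both determine `C`, and together determine `D`. -/
lemma uniformEntropy_submodular {A : Ω → α} {B : Ω → β} {C : Ω → γ} {D : Ω → δ}
    (hA : ∀ v w, A v = A w → C v = C w) (hB : ∀ v w, B v = B w → C v = C w)
    (hD : ∀ v w, A v = A w → B v = B w → D v = D w) :
    uniformEntropy D + uniformEntropy C ≤ uniformEntropy A + uniformEntropy B := by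
  have h1 := uniformEntropy_prod_submodular hA hB
  have h2 : uniformEntropy D ≤ uniformEntropy (fun w => (A w, B w)) :=
    uniformEntropy_mono fun v w h => hD v w (Prod.ext_iff.1 h).1 (Prod.ext_iff.1 h).2
  linarith

lemma uniformEntropy_pi_le_sum {ι : Type*} [Fintype ι] {α : ι → Type*} (X : ∀ i, Ω → α i) :
    uniformEntropy (fun w i => X i w) ≤ ∑ i, uniformEntropy (X i) := by
  classical
  have key : ∀ s : Finset ι, uniformEntropy (fun w (i : s) => X i w) ≤
      ∑ i ∈ s, uniformEntropy (X i) := by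
    intro s
    induction s using Finset.induction_on with
    | empty =>
      rw [sum_empty, ← uniformEntropy_const (Ω := Ω) ()]
      exact uniformEntropy_mono fun v w _ => funext fun i => absurd i.2 (notMem_empty _)
    | insert a s ha ih =>
      rw [sum_insert ha]
      have := uniformEntropy_submodular (A := X a) (B := fun w (i : s) => X i w)
        (C := fun _ : Ω => ()) (D := fun w (i : (insert a s : Finset ι)) => X i w)
        (fun _ _ _ => rfl) (fun _ _ _ => rfl) (by
          intro v w h1 h2
          ext ⟨i, hi⟩
          rcases mem_insert.1 hi with rfl | hi
          · exact h1
          · exact congrFun h2 ⟨i, hi⟩)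
      rw [uniformEntropy_const] at this
      linarith
  refine le_trans (uniformEntropy_mono fun v w h => ?_) (key univ)
  ext i
  exact congrFun h ⟨i, mem_univ i⟩

end UniformEntropy

/-! ### Conditional entropies for independent uniform coordinates. -/

section IndependentCoordinates

open Finset

variable {ι B α β : Type*}

lemma restrict_eq_restrict_iff {s : Finset ι} {v w : ι → B} :
    s.restrict v = s.restrict w ↔ ∀ i ∈ s, v i = w i := by
  simp [funext_iff]

variable [Fintype ι] [DecidableEq ι] [Fintype B]

/-- The entropy of a function of independent uniform coordinates, conditional on all the
coordinates but the `m`-th. -/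
noncomputable def entropyGivenOthers (m : ι) (X : (ι → B) → α) : ℝ :=
  uniformEntropy (fun w => (X w, ({m}ᶜ : Finset ι).restrict w)) -
    uniformEntropy (fun w : ι → B => ({m}ᶜ : Finset ι).restrict w)

lemma entropyGivenOthers_nonneg (m : ι) (X : (ι → B) → α) : 0 ≤ entropyGivenOthers m X :=
  sub_nonneg.2 (uniformEntropy_mono fun _ _ h => (Prod.ext_iff.1 h).2)

lemma uniformEntropy_restrict_compl_singleton [Nonempty B] (m : ι) :
    uniformEntropy (fun w : ι → B => ({m}ᶜ : Finset ι).restrict w) =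
      Real.log (Fintype.card (ι → B)) - Real.log (Fintype.card B) := by
  classical
  refine uniformEntropy_of_fiberCard_eq fun w => ?_
  rw [← Finset.card_univ, ← Finset.card_image_of_injective univ (Function.update_injective w m)]
  unfold fiberCard
  congr 1
  ext v
  simp only [restrict_eq_restrict_iff, mem_filter, mem_univ, true_and, mem_image, mem_compl,
    mem_singleton]
  constructor
  · intro h
    refine ⟨v m, ?_⟩
    ext i
    by_cases hi : i = m
    · subst hi; simp
    · simp [hi, h i hi]
  · rintro ⟨b, rfl⟩ i hi
    simp [hi]

/-- If a coordinate is determined by `X`, `Y` and the other coordinates, then `X` and `Y` carry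
all its entropy. -/
lemma log_card_le_entropyGivenOthers_add [Nonempty B] (m : ι) (X : (ι → B) → α)
    (Y : (ι → B) → β)
    (h : ∀ v w, X v = X w → Y v = Y w → (∀ i, i ≠ m → v i = w i) → v m = w m) :
    Real.log (Fintype.card B) ≤ entropyGivenOthers m X + entropyGivenOthers m Y := by
  have h1 := uniformEntropy_submodular
    (A := fun w => (X w, ({m}ᶜ : Finset ι).restrict w))
    (B := fun w => (Y w, ({m}ᶜ : Finset ι).restrict w))
    (C := fun w => ({m}ᶜ : Finset ι).restrict w) (D := fun w => w)
    (fun _ _ h => (Prod.ext_iff.1 h).2) (fun _ _ h => (Prod.ext_iff.1 h).2) (by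
      intro v w hX hY
      have ho : ∀ i, i ≠ m → v i = w i := by
        simpa using restrict_eq_restrict_iff.1 (Prod.ext_iff.1 hX).2
      ext i
      by_cases hi : i = m
      · subst hi
        exact h v w (Prod.ext_iff.1 hX).1 (Prod.ext_iff.1 hY).1 ho
      · exact ho i hi)
  rw [uniformEntropy_of_injective (X := fun w : ι → B => w) (fun _ _ h => h)] at h1
  have h2 := uniformEntropy_restrict_compl_singleton (B := B) m
  unfold entropyGivenOthers
  linarith

lemma log_card_le_uniformEntropy_eval [Nonempty B] (k : ι) :
    Real.log (Fintype.card B) ≤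
      uniformEntropy (fun w : ι → B => ({k} : Finset ι).restrict w) := by
  have h1 := uniformEntropy_submodular
    (A := fun w : ι → B => ({k} : Finset ι).restrict w)
    (B := fun w => ({k}ᶜ : Finset ι).restrict w)
    (C := fun _ => ()) (D := fun w => w) (fun _ _ _ => rfl) (fun _ _ _ => rfl) (by
      intro v w h1 h2
      rw [restrict_eq_restrict_iff] at h1 h2
      ext i
      by_cases hi : i ∈ ({k} : Finset ι)
      · exact h1 i hi
      · exact h2 i (mem_compl.2 hi))
  rw [uniformEntropy_of_injective (X := fun w : ι → B => w) (fun _ _ h => h),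
    uniformEntropy_const, uniformEntropy_restrict_compl_singleton] at h1
  linarith

/-- Revealing the coordinates one at a time along a walk: each `X m` depends on the coordinates
`m` and `τ m` only, and the walk by `τ` cannot leave a proper set of coordinates invariant. -/
lemma sum_entropyGivenOthers_le_sub (τ : ι → ι)
    (hτ : ∀ S : Finset ι, S.Nonempty → S ≠ univ → ∃ m ∉ S, τ m ∈ S)
    (A : (ι → B) → α) {β : ι → Type*} (X : ∀ m, (ι → B) → β m)
    (hAX : ∀ m v w, A v = A w → X m v = X m w)
    (hX : ∀ m v w, v m = w m → v (τ m) = w (τ m) → X m v = X m w)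
    (S : Finset ι) (hS : S.Nonempty) :
    ∑ m ∈ Sᶜ, entropyGivenOthers m (X m) ≤
      uniformEntropy (fun w => (A w, S.restrict w)) -
        uniformEntropy (fun w : ι → B => S.restrict w) := by
  induction hn : #(Sᶜ) generalizing S with
  | zero =>
    rw [card_eq_zero.1 hn, sum_empty]
    exact sub_nonneg.2 (uniformEntropy_mono fun _ _ h => (Prod.ext_iff.1 h).2)
  | succ n ih =>
    have hne : S ≠ univ := by
      rintro rfl
      simp at hn
    obtain ⟨m, hm, hτm⟩ := hτ S hS hne
    have hcompl : Sᶜ = insert m (insert m S)ᶜ := by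
      ext i
      by_cases hi : i = m <;> simp [hi, hm]
    have hmn : m ∉ (insert m S)ᶜ := by simp
    have ih' := ih (insert m S) (insert_nonempty _ _) (by
      rw [hcompl, card_insert_of_notMem hmn] at hn
      omega)
    rw [hcompl, sum_insert hmn]
    -- Conditioning on more coordinates lowers entropy: the entropy of `X m` given `S` is at least
    -- that given all coordinates but `m`.
    have ha := uniformEntropy_submodular
      (A := fun w : ι → B => (X m w, S.restrict w))
      (B := fun w => ({m}ᶜ : Finset ι).restrict w)
      (C := fun w => S.restrict w)
      (D := fun w => (X m w, ({m}ᶜ : Finset ι).restrict w))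
      (fun _ _ h => (Prod.ext_iff.1 h).2)
      (fun v w h => restrict_eq_restrict_iff.2 fun i hi =>
        restrict_eq_restrict_iff.1 h i (by
          simp only [mem_compl, mem_singleton]
          rintro rfl
          exact hm hi))
      (fun v w h1 h2 => Prod.ext (Prod.ext_iff.1 h1).1 h2)
    -- Since `τ m ∈ S`, revealing `m` determines `X m`. So the entropy of `A` given `S` drops by at
    -- least that of `X m` given `S`.
    have hb := uniformEntropy_submodular
      (A := fun w : ι → B => (A w, S.restrict w))
      (B := fun w => (insert m S).restrict w)
      (C := fun w => (X m w, S.restrict w))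
      (D := fun w => (A w, (insert m S).restrict w))
      (fun v w h => Prod.ext (hAX m v w (Prod.ext_iff.1 h).1) (Prod.ext_iff.1 h).2)
      (fun v w h => by
        rw [restrict_eq_restrict_iff] at h
        refine Prod.ext (hX m v w (h m (mem_insert_self _ _)) (h _ (mem_insert_of_mem hτm))) ?_
        exact restrict_eq_restrict_iff.2 fun i hi => h i (mem_insert_of_mem hi))
      (fun v w h1 h2 => Prod.ext (Prod.ext_iff.1 h1).1 h2)
    unfold entropyGivenOthers at *
    linarith

lemma log_card_add_sum_entropyGivenOthers_le [Nonempty B] (τ : ι → ι)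
    (hτ : ∀ S : Finset ι, S.Nonempty → S ≠ univ → ∃ m ∉ S, τ m ∈ S)
    (A : (ι → B) → α) {β : ι → Type*} (X : ∀ m, (ι → B) → β m)
    (hAX : ∀ m v w, A v = A w → X m v = X m w)
    (hX : ∀ m v w, v m = w m → v (τ m) = w (τ m) → X m v = X m w)
    (k : ι) (hk : ∀ v w, A v = A w → v k = w k) :
    Real.log (Fintype.card B) + ∑ m ∈ {k}ᶜ, entropyGivenOthers m (X m) ≤ uniformEntropy A := by
  have h1 := sum_entropyGivenOthers_le_sub τ hτ A X hAX hX {k} (singleton_nonempty k)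
  have h2 := log_card_le_uniformEntropy_eval (B := B) k
  have h3 : uniformEntropy (fun w : ι → B => (A w, ({k} : Finset ι).restrict w)) ≤
      uniformEntropy A := uniformEntropy_mono fun v w h => Prod.ext h
        (restrict_eq_restrict_iff.2 fun i hi => by
          rw [mem_singleton.1 hi]
          exact hk v w h)
  linarith

end IndependentCoordinates

/-! ### The cycle, for fixed answering functions. -/

section CyclicAnswers

open Finset

/-- Otherwise the complement of `S` is stable under `τ`, and no orbit starting there reaches `S`. -/
lemma exists_notMem_apply_mem {ι : Type*} (τ : Equiv.Perm ι)
    (hτ : ∀ x y, ∃ n : ℕ, (τ ^ n) x = y) [Fintype ι] (S : Finset ι) (hS : S.Nonempty)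
    (hne : S ≠ univ) : ∃ m ∉ S, τ m ∈ S := by
  classical
  by_contra! hcon
  obtain ⟨s, hs⟩ := hS
  obtain ⟨m, hm⟩ : ∃ m, m ∉ S := by
    by_contra! h
    exact hne (eq_univ_of_forall h)
  obtain ⟨n, hn⟩ := hτ m s
  have : ∀ n : ℕ, (τ ^ n) m ∉ S := by
    intro n
    induction n with
    | zero => simpa using hm
    | succ n ih => rw [pow_succ', Equiv.Perm.mul_apply]; exact hcon _ ih
  exact this n (hn ▸ hs)

lemma exists_pow_finRotate_eq {K : ℕ} (hK : 2 ≤ K) (x y : Fin K) :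
    ∃ n : ℕ, (finRotate K ^ n) x = y := by
  have h := fun z : Fin K => Equiv.Perm.mem_support.1
    ((support_finRotate_of_le hK).symm ▸ mem_univ z)
  obtain ⟨n, -, hn⟩ := ((isCycle_finRotate_of_le hK).sameCycle (h x) (h y)).exists_pow_eq'
  exact ⟨n, hn⟩

lemma exists_pow_finRotate_symm_eq {K : ℕ} (hK : 2 ≤ K) (x y : Fin K) :
    ∃ n : ℕ, ((finRotate K)⁻¹ ^ n) x = y := by
  obtain ⟨n, hn⟩ := exists_pow_finRotate_eq hK y x
  exact ⟨n, by rw [inv_pow, Equiv.Perm.inv_eq_iff_eq, hn]⟩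

variable {K : ℕ} {B : Type*} [Fintype B] [Nonempty B] {α : Fin K → Type*}

/-- The walks in the two directions charge each message other than `k` to its two databases in turn.
-/
lemma two_mul_log_card_add_le (hK : 2 ≤ K) (G : ∀ n, (Fin K → B) → α n)
    (hG : ∀ n v w, (∀ m ∈ cyclicStorage K n, v m = w m) → G n v = G n w)
    (k : Fin K) (hk : ∀ v w, (∀ n, G n v = G n w) → v k = w k) :
    2 * Real.log (Fintype.card B) +
      ∑ m ∈ {k}ᶜ, (entropyGivenOthers m (G m) +
        entropyGivenOthers m (G ((finRotate K)⁻¹ m))) ≤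
      2 * ∑ n, uniformEntropy (G n) := by
  have hk' : ∀ v w, (fun n => G n v) = (fun n => G n w) → v k = w k :=
    fun v w h => hk v w fun n => congrFun h n
  have h1 := log_card_add_sum_entropyGivenOthers_le (finRotate K)
    (exists_notMem_apply_mem _ (exists_pow_finRotate_eq hK)) (fun w n => G n w)
    (fun m => G m) (fun m v w h => congrFun h m)
    (fun m v w h h' => hG m v w fun i hi => by
      rcases mem_insert.1 hi with rfl | hi
      · exact h
      · rw [mem_singleton.1 hi]; exact h') k hk'
  have h2 := log_card_add_sum_entropyGivenOthers_le (⇑(finRotate K)⁻¹)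
    (exists_notMem_apply_mem _ (exists_pow_finRotate_symm_eq hK)) (fun w n => G n w)
    (fun m => G ((finRotate K)⁻¹ m)) (fun m v w h => congrFun h _)
    (fun m v w h h' => hG _ v w fun i hi => by
      rcases mem_insert.1 hi with rfl | hi
      · exact h'
      · rw [mem_singleton.1 hi, Equiv.Perm.inv_def, Equiv.apply_symm_apply]; exact h) k hk'
  have h3 := uniformEntropy_pi_le_sum G
  rw [sum_add_distrib]
  linarith

lemma log_card_le_entropyGivenOthers_incident (G : ∀ n, (Fin K → B) → α n)
    (hG : ∀ n v w, (∀ m ∈ cyclicStorage K n, v m = w m) → G n v = G n w)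
    (m : Fin K) (hm : ∀ v w, (∀ n, G n v = G n w) → v m = w m) :
    Real.log (Fintype.card B) ≤ entropyGivenOthers m (G m) +
      entropyGivenOthers m (G ((finRotate K)⁻¹ m)) := by
  refine log_card_le_entropyGivenOthers_add m _ _ fun v w h1 h2 h3 => hm v w fun n => ?_
  by_cases hn : n = m
  · exact hn ▸ h1
  by_cases hn' : n = (finRotate K)⁻¹ m
  · exact hn' ▸ h2
  refine hG n v w fun i hi => h3 i ?_
  rcases mem_insert.1 hi with rfl | hi
  · exact hn
  · rw [mem_singleton.1 hi]
    rintro rfl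
    exact hn' (Equiv.symm_apply_apply _ _).symm

end CyclicAnswers

/-! ### From entropy given the queries to Shannon entropy. -/

section RandomFunctions

variable {Ω M α : Type} [MeasurableSpace Ω] [Fintype M]

open Classical in
lemma tsum_negMulLog_fiber [Nonempty M] {q : ℕ} (hq : 1 < q) (G : M → α) :
    ∑' a, ENNReal.ofReal (Real.negMulLog
      ((Finset.card {w | G w = a} : ℝ) / Fintype.card M) / Real.log q) =
      ENNReal.ofReal (uniformEntropy G / Real.log q) := by
  have hlog : 0 < Real.log q := Real.log_pos (by exact_mod_cast hq)
  have hM : (0 : ℝ) < Fintype.card M := by exact_mod_cast Fintype.card_pos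
  rw [tsum_eq_sum (s := Finset.univ.image G)]
  · rw [← ENNReal.ofReal_sum_of_nonneg]
    · congr 1
      rw [← Finset.sum_div]
      congr 1
      unfold uniformEntropy
      rw [Finset.sum_div, ← Finset.sum_fiberwise_of_maps_to (s := Finset.univ)
        (t := Finset.univ.image G) (g := G) (fun w hw => Finset.mem_image_of_mem G hw)]
      refine Finset.sum_congr rfl fun a ha => ?_
      obtain ⟨w₀, -, rfl⟩ := Finset.mem_image.1 ha
      have hpos : (0 : ℝ) < Finset.card {w | G w = G w₀} := by
        exact_mod_cast fiberCard_pos G w₀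
      rw [Finset.sum_congr rfl (g := fun _ => (Real.log (Fintype.card M) -
        Real.log (Finset.card {w | G w = G w₀})) / Fintype.card M), Finset.sum_const,
        nsmul_eq_mul, Real.negMulLog, Real.log_div hpos.ne' hM.ne']
      · ring
      · intro w hw
        simp only [Finset.mem_filter, Finset.mem_univ, true_and] at hw
        rw [fiberCard_congr hw, fiberCard]
    · intro a _
      refine div_nonneg (Real.negMulLog_nonneg (by positivity) ?_) hlog.le
      rw [div_le_one hM]
      exact_mod_cast Finset.card_le_univ _
  · intro a ha
    have : (Finset.univ.filter fun w => G w = a) = ∅ := by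
      refine Finset.filter_eq_empty_iff.2 fun w _ h => ha ?_
      exact Finset.mem_image.2 ⟨w, Finset.mem_univ _, h⟩
    simp [this]

variable [MeasurableSpace M] [DiscreteMeasurableSpace M]
  [Countable α] [MeasurableSpace α] [DiscreteMeasurableSpace α]

open Classical in
lemma measureReal_preimage_eq_integral (P : Measure Ω) [IsProbabilityMeasure P]
    {W : Ω → M} (hW : Measurable W) (hunif : ∀ w, P.real (W ⁻¹' {w}) = (Fintype.card M : ℝ)⁻¹)
    {G : Ω → M → α} (hG : Measurable G) (hind : IndepFun W G P)
    {A : Ω → α} (hA : ∀ᵐ ω ∂P, A ω = G ω (W ω)) (a : α) :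
    P.real (A ⁻¹' {a}) =
      ∫ ω, (Finset.card {w | G ω w = a} : ℝ) / Fintype.card M ∂P := by
  have hGm : ∀ w, MeasurableSet {g : M → α | g w = a} := fun w =>
    measurable_pi_apply (X := fun _ : M => α) w (measurableSet_singleton a)
  have h1 : P.real (A ⁻¹' {a}) = ∑ w, P.real (W ⁻¹' {w} ∩ G ⁻¹' {g | g w = a}) := by
    rw [← measureReal_biUnion_finset]
    · refine measureReal_congr ?_
      filter_upwards [hA] with ω hω
      refine propext ?_
      change A ω = a ↔
        ω ∈ ⋃ w ∈ (Finset.univ : Finset M), W ⁻¹' {w} ∩ G ⁻¹' {g | g w = a}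
      simp [hω]
    · intro u _ v _ huv
      refine Set.disjoint_left.2 fun ω hu hv => huv ?_
      exact hu.1.symm.trans hv.1
    · exact fun w _ => (hW (measurableSet_singleton w)).inter (hG (hGm w))
  have h2 : ∀ ω, (Finset.card {w | G ω w = a} : ℝ) / Fintype.card M =
      ∑ w, (G ⁻¹' {g | g w = a}).indicator (fun _ => (Fintype.card M : ℝ)⁻¹) ω := by
    intro ω
    simp only [Set.indicator_apply, Set.mem_preimage, Set.mem_ofPred_eq]
    rw [← Finset.sum_filter, Finset.sum_const, nsmul_eq_mul, div_eq_mul_inv]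
  simp_rw [h2]
  rw [integral_finsetSum _ fun w _ => (integrable_const _).indicator (hG (hGm w)), h1]
  refine Finset.sum_congr rfl fun w _ => ?_
  rw [integral_indicator_const _ (hG (hGm w)), measureReal_def,
    hind.measure_inter_preimage_eq_mul _ _ (measurableSet_singleton w) (hGm w),
    ENNReal.toReal_mul, ← measureReal_def, hunif, smul_eq_mul, mul_comm, measureReal_def]

/-- The entropy of a random function `G`, evaluated at an independent uniform argument, is at
least the expected entropy of its value given `G`. -/
lemma lintegral_uniformEntropy_le_shannonEntropy [Nonempty M] {q : ℕ} (hq : 1 < q) (P : Measure Ω)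
    [IsProbabilityMeasure P] {W : Ω → M} (hW : Measurable W)
    (hunif : ∀ w, P.real (W ⁻¹' {w}) = (Fintype.card M : ℝ)⁻¹)
    {G : Ω → M → α} (hG : Measurable G) (hind : IndepFun W G P)
    {A : Ω → α} (hA : ∀ᵐ ω ∂P, A ω = G ω (W ω)) :
    ∫⁻ ω, ENNReal.ofReal (uniformEntropy (G ω) / Real.log q) ∂P ≤ shannonEntropy q P A := by
  classical
  have hlog : 0 < Real.log q := Real.log_pos (by exact_mod_cast hq)
  have hM : (0 : ℝ) < Fintype.card M := by exact_mod_cast Fintype.card_pos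
  -- `M → α` is countable and discrete, as `M` is finite, so measurability of `φ` is automatic.
  have hmeas : ∀ φ : (M → α) → ℝ, Measurable fun ω => φ (G ω) := fun φ =>
    (Measurable.of_discrete (f := φ)).comp hG
  simp_rw [← tsum_negMulLog_fiber hq]
  rw [lintegral_tsum fun a => (hmeas fun g => Real.negMulLog
    ((Finset.card {w | g w = a} : ℝ) / Fintype.card M) / Real.log q).ennreal_ofReal.aemeasurable]
  refine ENNReal.tsum_le_tsum fun a => ?_
  rw [measureReal_preimage_eq_integral P hW hunif hG hind hA a]
  set p : Ω → ℝ := fun ω => (Finset.card {w | G ω w = a} : ℝ) / Fintype.card M with hp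
  have hpm : Measurable p := hmeas fun g => (Finset.card {w | g w = a} : ℝ) / Fintype.card M
  have hp0 : ∀ ω, 0 ≤ p ω := fun ω => by positivity
  have hp1 : ∀ ω, p ω ≤ 1 := fun ω => by
    rw [hp, div_le_one hM]
    exact_mod_cast Finset.card_le_univ _
  have hpi : Integrable p P := Integrable.of_bound hpm.aestronglyMeasurable 1
    (.of_forall fun ω => by rw [Real.norm_of_nonneg (hp0 ω)]; exact hp1 ω)
  have hli : Integrable (fun ω => Real.negMulLog (p ω)) P :=
    Integrable.of_bound (Real.continuous_negMulLog.measurable.comp hpm).aestronglyMeasurable 1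
      (.of_forall fun ω => by
        rw [Real.norm_of_nonneg (Real.negMulLog_nonneg (hp0 ω) (hp1 ω))]
        have := Real.negMulLog_le_one_sub_self (hp0 ω)
        linarith [hp0 ω])
  -- Conditioning on `G` reduces entropy: Jensen, value by value of the answer.
  have hjensen : ∫ ω, Real.negMulLog (p ω) ∂P ≤ Real.negMulLog (∫ ω, p ω ∂P) :=
    Real.concaveOn_negMulLog.le_map_integral Real.continuous_negMulLog.continuousOn isClosed_Ici
      (.of_forall hp0) hpi hli
  rw [← ofReal_integral_eq_lintegral_ofReal (hli.div_const _)
    (.of_forall fun ω => div_nonneg (Real.negMulLog_nonneg (hp0 ω) (hp1 ω)) hlog.le),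
    integral_div]
  exact ENNReal.ofReal_le_ofReal (div_le_div_of_nonneg_right hjensen hlog.le)

end RandomFunctions

/-! ### What privacy and reliability say about the answering functions. -/

namespace PIRScheme

variable {F : Type} [Fintype F] [MeasurableSpace F] {K N : ℕ}
  {Z : Fin N → Finset (Fin K)} {L : ℕ}

lemma measureReal_preimage_W (S : PIRScheme F Z L) (w : Fin K → Fin L → F) :
    S.P.real (S.W ⁻¹' {w}) = (Fintype.card (Fin K → Fin L → F) : ℝ)⁻¹ := by
  rw [measureReal_def, S.uniform_W w]
  simp [← pow_mul, mul_comm K L]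

/-- In a private scheme, the answering function of each database can be chosen independently
of the desired message. -/
lemma IsPrivate.exists_answer_function {S : PIRScheme F Z L} (hS : S.IsPrivate) (k₀ : Fin K) :
    ∃ g : ∀ n, S.Query n → (Fin K → Fin L → F) → S.Answer n, (∀ n, Measurable (g n)) ∧
      (∀ n q v w, (∀ m ∈ Z n, v m = w m) → g n q v = g n q w) ∧
      ∀ k n, ∀ᵐ ω ∂S.P, S.A k n ω = g n (S.Q k n ω) (S.W ω) := by
  choose f hf hA using S.answer_deterministic k₀
  refine ⟨fun n q w => f n (q, fun m => w m), fun n => ?_, fun n q v w h => ?_, fun k n => ?_⟩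
  · exact measurable_pi_iff.2 fun w => (hf n).comp (measurable_id.prodMk measurable_const)
  · dsimp only
    congr 2
    ext1 m
    exact h m m.2
  · have hmeas : ∀ k, Measurable fun ω => (S.Q k n ω, S.A k n ω, S.W ω) := fun k =>
      (S.measurable_Q k n).prodMk ((S.measurable_A k n).prodMk S.measurable_W)
    have hset : MeasurableSet {x : S.Query n × S.Answer n × (Fin K → Fin L → F) |
        x.2.1 = f n (x.1, fun m => x.2.2 m)} := by
      refine measurableSet_eq_fun (measurable_fst.comp measurable_snd) ((hf n).comp ?_)
      exact measurable_fst.prodMk (measurable_pi_iff.2 fun m =>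
        (measurable_pi_apply _).comp (measurable_snd.comp measurable_snd))
    -- The identity "answer = `f` of query and contents" is an event of the joint law that privacy
    -- preserves.
    have h0 := (ae_map_iff (hmeas k₀).aemeasurable hset).2 (hA n)
    rw [hS n k₀ k] at h0
    exact (ae_map_iff (hmeas k).aemeasurable hset).1 h0

/-- Almost surely, the answering functions selected by the queries determine the desired
message, whatever the contents of the databases. -/
lemma IsReliable.ae_determined [DiscreteMeasurableSpace F] [Nonempty F] {S : PIRScheme F Z L} (hS : S.IsReliable)
    {g : ∀ n, S.Query n → (Fin K → Fin L → F) → S.Answer n} (hg : ∀ n, Measurable (g n))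
    (k : Fin K) (hA : ∀ n, ∀ᵐ ω ∂S.P, S.A k n ω = g n (S.Q k n ω) (S.W ω)) :
    ∀ᵐ ω ∂S.P, ∀ v w : Fin K → Fin L → F,
      (∀ n, g n (S.Q k n ω) v = g n (S.Q k n ω) w) → v k = w k := by
  obtain ⟨dec, hdec, hrel⟩ := hS k
  have key : ∀ w : Fin K → Fin L → F, ∀ᵐ ω ∂S.P,
      dec (fun n => S.Q k n ω, fun n => g n (S.Q k n ω) w) = w k := by
    intro w
    set T : Set ((n : Fin N) → S.Query n) := {q | dec (q, fun n => g n (q n) w) ≠ w k} with hT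
    have hTm : MeasurableSet T := by
      have : Measurable fun q : (n : Fin N) → S.Query n => dec (q, fun n => g n (q n) w) :=
        hdec.comp (measurable_id.prodMk (measurable_pi_iff.2 fun n =>
          (measurable_pi_apply w).comp ((hg n).comp (measurable_pi_apply n))))
      exact (this (measurableSet_singleton (w k))).compl
    -- The contents `w` have positive probability independently of the queries, so queries that fail
    -- to decode `w` must be null.
    have hmul := (S.indep k).measure_inter_preimage_eq_mul _ _ (measurableSet_singleton w) hTm
    have hzero : S.P (S.W ⁻¹' {w} ∩ (fun ω n => S.Q k n ω) ⁻¹' T) = 0 := by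
      refine measure_mono_null ?_ (hrel.and (ae_all_iff.2 hA))
      rintro ω ⟨hW, hQ⟩ ⟨h1, h2⟩
      have hW : S.W ω = w := hW
      rw [funext h2, hW] at h1
      exact hQ h1
    rw [hzero, eq_comm, mul_eq_zero, S.uniform_W w] at hmul
    rcases hmul with h | h
    · simp [ENNReal.pow_eq_top_iff] at h
    · exact measure_mono_null (fun ω hω => hω) h
  filter_upwards [ae_all_iff.2 key] with ω hω v w h
  rw [← hω v, ← hω w, funext h]

end PIRScheme

/-! ### The converse bound, averaged over the queries. -/

namespace PIRScheme

open Finset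

variable {F : Type} [Fintype F] [MeasurableSpace F] [DiscreteMeasurableSpace F] {K L : ℕ}

/-- The total answer entropy of a private and reliable scheme on the cycle. -/
lemma mul_length_le_two_mul_sum_shannonEntropy [Nontrivial F] (hK : 2 ≤ K)
    {S : PIRScheme F (cyclicStorage K) L} (hpriv : S.IsPrivate) (hrel : S.IsReliable)
    (k : Fin K) :
    ((K : ℝ≥0∞) + 1) * L ≤ 2 * ∑ n, shannonEntropy (Fintype.card F) S.P (S.A k n) := by
  obtain ⟨g, hg, hgloc, hA⟩ := hpriv.exists_answer_function k
  have hq : 1 < Fintype.card F := Fintype.one_lt_card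
  have hlog : 0 < Real.log (Fintype.card F) := Real.log_pos (by exact_mod_cast hq)
  have hcard : Real.log (Fintype.card (Fin L → F)) = L * Real.log (Fintype.card F) := by
    simp
  -- Converts nats to base-`|F|` units in `[0, ∞]`; additive on nonnegative reals.
  set c : ℝ → ℝ≥0∞ := fun x => ENNReal.ofReal (x / Real.log (Fintype.card F)) with hc
  have hcmono : Monotone c := fun x y h =>
    ENNReal.ofReal_le_ofReal (div_le_div_of_nonneg_right h hlog.le)
  have hcadd : ∀ {x y}, 0 ≤ x → 0 ≤ y → c (x + y) = c x + c y := fun hx hy => by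
    simp only [hc]
    rw [add_div, ENNReal.ofReal_add (div_nonneg hx hlog.le) (div_nonneg hy hlog.le)]
  have hcsum : ∀ (s : Finset (Fin K)) (f : Fin K → ℝ), (∀ i, 0 ≤ f i) →
      c (∑ i ∈ s, f i) = ∑ i ∈ s, c (f i) := fun s f hf => by
    simp only [hc]
    rw [sum_div, ENNReal.ofReal_sum_of_nonneg fun i _ => div_nonneg (hf i) hlog.le]
  have hcL : c (Real.log (Fintype.card (Fin L → F))) = L := by
    simp only [hc]
    rw [hcard, mul_div_cancel_right₀ _ hlog.ne', ENNReal.ofReal_natCast]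
  have hLnn : 0 ≤ Real.log (Fintype.card (Fin L → F)) := by rw [hcard]; positivity
  have hmeas : ∀ k n (φ : ((Fin K → Fin L → F) → S.Answer n) → ℝ),
      Measurable fun ω => c (φ (g n (S.Q k n ω))) := fun k n φ =>
    (Measurable.of_discrete (f := fun h => c (φ h))).comp ((hg n).comp (S.measurable_Q k n))
  have hlaw : ∀ n i j (φ : ((Fin K → Fin L → F) → S.Answer n) → ℝ),
      ∫⁻ ω, c (φ (g n (S.Q i n ω))) ∂S.P = ∫⁻ ω, c (φ (g n (S.Q j n ω))) ∂S.P := by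
    intro n i j φ
    have hm : ∀ k, Measurable fun ω => (S.Q k n ω, S.A k n ω, S.W ω) := fun k =>
      (S.measurable_Q k n).prodMk ((S.measurable_A k n).prodMk S.measurable_W)
    have hφ : Measurable fun x : S.Query n × S.Answer n × (Fin K → Fin L → F) =>
        c (φ (g n x.1)) :=
      (Measurable.of_discrete (f := fun h => c (φ h))).comp ((hg n).comp measurable_fst)
    have := congrArg (fun μ => ∫⁻ x, c (φ (g n x.1)) ∂μ) (hpriv n i j)
    simpa only [lintegral_map hφ (hm _)] using this
  set u : Fin K → (n : Fin K) → Fin K → ℝ≥0∞ := fun k n m =>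
    ∫⁻ ω, c (entropyGivenOthers m (g n (S.Q k n ω))) ∂S.P with hu
  have hincident : ∀ m, (L : ℝ≥0∞) ≤ u k m m + u k ((finRotate K)⁻¹ m) m := by
    intro m
    simp only [hu]
    -- Privacy replaces the desired index `k` by `m`, one database at a time; only then do the two
    -- answers have to determine message `m`.
    rw [hlaw m k m, hlaw _ k m, ← lintegral_add_left (hmeas _ _ _)]
    calc (L : ℝ≥0∞) = ∫⁻ _, (L : ℝ≥0∞) ∂S.P := by simp
      _ ≤ _ := by
        refine lintegral_mono_ae ?_
        filter_upwards [hrel.ae_determined hg m (hA m)] with ω hω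
        rw [← hcL, ← hcadd (entropyGivenOthers_nonneg _ _) (entropyGivenOthers_nonneg _ _)]
        exact hcmono (log_card_le_entropyGivenOthers_incident (fun n => g n (S.Q m n ω))
          (fun n => hgloc n _) m hω)
  have htotal : 2 * (L : ℝ≥0∞) + ∑ m ∈ {k}ᶜ, (u k m m + u k ((finRotate K)⁻¹ m) m) ≤
      2 * ∑ n, ∫⁻ ω, c (uniformEntropy (g n (S.Q k n ω))) ∂S.P := by
    simp only [hu]
    simp_rw [← lintegral_add_left (hmeas _ _ _)]
    have hadd : ∀ m ∈ ({k}ᶜ : Finset (Fin K)), Measurable fun ω =>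
        c (entropyGivenOthers m (g m (S.Q k m ω))) +
          c (entropyGivenOthers m (g ((finRotate K)⁻¹ m) (S.Q k ((finRotate K)⁻¹ m) ω))) :=
      fun m _ => (hmeas _ _ _).add (hmeas _ _ _)
    rw [← lintegral_finsetSum _ hadd,
      ← lintegral_finsetSum _ fun m _ => hmeas _ _ _,
      ← lintegral_const_mul _ (Finset.measurable_fun_sum _ fun m _ => hmeas _ _ _)]
    calc _ = ∫⁻ ω, (2 * (L : ℝ≥0∞) + ∑ m ∈ {k}ᶜ,
          (c (entropyGivenOthers m (g m (S.Q k m ω))) +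
            c (entropyGivenOthers m (g ((finRotate K)⁻¹ m)
              (S.Q k ((finRotate K)⁻¹ m) ω))))) ∂S.P := by
          rw [lintegral_add_left measurable_const]
          simp
      _ ≤ _ := by
        refine lintegral_mono_ae ?_
        filter_upwards [hrel.ae_determined hg k (hA k)] with ω hω
        have := hcmono (two_mul_log_card_add_le hK (fun n => g n (S.Q k n ω))
          (fun n => hgloc n _) k hω)
        have hnn : ∀ m, 0 ≤ entropyGivenOthers m (g m (S.Q k m ω)) +
            entropyGivenOthers m (g ((finRotate K)⁻¹ m) (S.Q k ((finRotate K)⁻¹ m) ω)) :=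
          fun m => add_nonneg (entropyGivenOthers_nonneg _ _) (entropyGivenOthers_nonneg _ _)
        rw [two_mul, two_mul, hcadd (add_nonneg hLnn hLnn) (sum_nonneg fun m _ => hnn m),
          hcadd hLnn hLnn, hcL, hcsum _ _ hnn,
          hcadd (sum_nonneg fun n _ => uniformEntropy_nonneg _)
            (sum_nonneg fun n _ => uniformEntropy_nonneg _),
          hcsum _ _ fun n => uniformEntropy_nonneg _, ← two_mul, ← two_mul] at this
        simpa only [hcadd (entropyGivenOthers_nonneg _ _) (entropyGivenOthers_nonneg _ _)]
          using this
  have hentropy : ∀ n, ∫⁻ ω, c (uniformEntropy (g n (S.Q k n ω))) ∂S.P ≤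
      shannonEntropy (Fintype.card F) S.P (S.A k n) := by
    intro n
    refine lintegral_uniformEntropy_le_shannonEntropy hq S.P S.measurable_W
      S.measureReal_preimage_W ((hg n).comp (S.measurable_Q k n)) ?_ (hA k n)
    exact (S.indep k).comp measurable_id ((hg n).comp (measurable_pi_apply n))
  calc ((K : ℝ≥0∞) + 1) * L = 2 * (L : ℝ≥0∞) + ∑ m ∈ ({k}ᶜ : Finset (Fin K)), (L : ℝ≥0∞) := by
        have hK' : K + 1 = 2 + (K - 1) := by omega
        rw [sum_const, card_compl, card_singleton, Fintype.card_fin, nsmul_eq_mul, ← add_mul]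
        congr 1
        exact_mod_cast hK'
    _ ≤ 2 * (L : ℝ≥0∞) + ∑ m ∈ {k}ᶜ, (u k m m + u k ((finRotate K)⁻¹ m) m) := by
        gcongr with m
        exact hincident m
    _ ≤ _ := htotal
    _ ≤ _ := by gcongr with n; exact hentropy n

/-- The converse bound on the rate. -/
lemma rate_le_of_isPrivate_of_isReliable [Nontrivial F] (hK : 2 ≤ K)
    {S : PIRScheme F (cyclicStorage K) L} (hpriv : S.IsPrivate) (hrel : S.IsReliable)
    (k : Fin K) : S.rate k ≤ 2 / ((K : ℝ≥0∞) + 1) := by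
  refine ENNReal.div_le_of_le_mul ?_
  have h := mul_length_le_two_mul_sum_shannonEntropy hK hpriv hrel k
  have hpos : (K : ℝ≥0∞) + 1 ≠ 0 := by simp
  have hfin : (K : ℝ≥0∞) + 1 ≠ ∞ := by simp
  rw [div_eq_mul_inv, mul_right_comm, ← div_eq_mul_inv,
    ENNReal.le_div_iff_mul_le (.inl hpos) (.inl hfin), mul_comm]
  exact h

end PIRScheme

/-! ### Uniform laws and their symmetries. -/

section UniformMeasure

instance uniformOn_univ_isProbabilityMeasure {α : Type*} [Finite α] [Nonempty α]
    [MeasurableSpace α] [MeasurableSingletonClass α] :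
    IsProbabilityMeasure (uniformOn (Set.univ : Set α)) :=
  isProbabilityMeasure_uniformOn Set.finite_univ Set.univ_nonempty

lemma map_uniformOn_univ_of_involutive {α : Type*} [Fintype α] [MeasurableSpace α]
    [DiscreteMeasurableSpace α] {e : α → α} (he : Function.Involutive e) :
    (uniformOn (Set.univ : Set α)).map e = uniformOn Set.univ := by
  refine Measure.ext_of_singleton fun y => ?_
  have hpre : e ⁻¹' {y} = {e y} := by
    ext x
    exact he.eq_iff
  rw [Measure.map_apply Measurable.of_discrete (measurableSet_singleton y), hpre,
    uniformOn_univ, uniformOn_univ, Measure.count_singleton, Measure.count_singleton]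

end UniformMeasure

/-! ### Entropy of a variable with a frequent value. -/

section EntropyBound

variable {Ω α : Type} [MeasurableSpace Ω] [Fintype α] [MeasurableSpace α]
  [DiscreteMeasurableSpace α]

open Finset

/-- This is `negMulLog x ≤ 1 - x` at `x = p * N`. Summed over at most `N` values, the error terms
cost at most 1. -/
lemma negMulLog_le_mul_log_add {p N : ℝ} (hp : 0 ≤ p) (hN : 0 < N) :
    Real.negMulLog p ≤ p * Real.log N + N⁻¹ := by
  have h := Real.negMulLog_le_one_sub_self (mul_nonneg hp hN.le)
  rw [Real.negMulLog_mul, show Real.negMulLog N = -N * Real.log N from rfl] at h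
  have h2 : N * Real.negMulLog p ≤ N * (p * Real.log N + N⁻¹) := by
    rw [mul_add, mul_inv_cancel₀ hN.ne']
    nlinarith [mul_nonneg hp hN.le]
  exact le_of_mul_le_mul_left h2 hN

/-- A variable that often takes the value `a₀` has small entropy. -/
lemma shannonEntropy_le_of_fintype {q : ℕ} (hq : 1 < q) (P : Measure Ω) [IsProbabilityMeasure P]
    {X : Ω → α} (hX : Measurable X) (a₀ : α) :
    shannonEntropy q P X ≤ ENNReal.ofReal
      ((P.real {ω | X ω ≠ a₀} * Real.log (Fintype.card α) + 2) / Real.log q) := by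
  classical
  have : Nonempty α := ⟨a₀⟩
  have hlog : 0 < Real.log q := Real.log_pos (by exact_mod_cast hq)
  have hN : (0 : ℝ) < Fintype.card α := by exact_mod_cast Fintype.card_pos
  unfold shannonEntropy
  rw [tsum_fintype, ← ENNReal.ofReal_sum_of_nonneg fun a _ =>
    div_nonneg (Real.negMulLog_nonneg measureReal_nonneg measureReal_le_one) hlog.le]
  refine ENNReal.ofReal_le_ofReal ?_
  rw [← sum_div]
  refine div_le_div_of_nonneg_right ?_ hlog.le
  have hsum : ∑ a ∈ univ.erase a₀, P.real (X ⁻¹' {a}) = P.real {ω | X ω ≠ a₀} := by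
    rw [sum_measureReal_preimage_singleton _ fun a _ => hX (measurableSet_singleton a)]
    congr 1
    ext ω
    simp
  have hcard : ∑ _a ∈ univ.erase a₀, (Fintype.card α : ℝ)⁻¹ ≤ 1 := by
    rw [sum_const, nsmul_eq_mul, ← div_eq_mul_inv, div_le_one hN]
    exact_mod_cast card_le_univ _
  -- The 2 in the bound is 1 for the value `a₀` and 1 for the errors `hcard`.
  have h0 : Real.negMulLog (P.real (X ⁻¹' {a₀})) ≤ 1 := by
    have := Real.negMulLog_le_one_sub_self (measureReal_nonneg (μ := P) (s := X ⁻¹' {a₀}))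
    linarith [measureReal_nonneg (μ := P) (s := X ⁻¹' {a₀})]
  have h1 : ∑ a ∈ univ.erase a₀, Real.negMulLog (P.real (X ⁻¹' {a})) ≤
      ∑ a ∈ univ.erase a₀, (P.real (X ⁻¹' {a}) * Real.log (Fintype.card α) +
        (Fintype.card α : ℝ)⁻¹) :=
    sum_le_sum fun a _ => negMulLog_le_mul_log_add measureReal_nonneg hN
  rw [sum_add_distrib, ← sum_mul, hsum] at h1
  rw [← add_sum_erase _ _ (mem_univ a₀)]
  linarith

end EntropyBound

/-! ### The scheme attaining the bound asymptotically. -/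

section CyclicScheme

variable {F : Type} [Field F] {M L : ℕ}

/-- The selection bit at position `p` of the cycle traversed from `k`: it is `x` up to the
position of database `t`, and is flipped after it. -/
def selectionBit (k : Fin (M + 1)) (r : Fin (M + 1) × Bool) (p : ℕ) : Bool :=
  if p ≤ (r.1 - k).val then r.2 else !r.2

/-- The query to database `n` for message `k`, from a random flip position and a random bit. -/
def cyclicQuery (k n : Fin (M + 1)) (r : Fin (M + 1) × Bool) : Bool × Bool :=
  (selectionBit k r (n - k).val, selectionBit k r ((n - k).val + 1))

/-- The query to database `n` in terms of the first bit it receives. -/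
def localQuery (n : Fin (M + 1)) (r : Fin (M + 1) × Bool) : Bool × Bool :=
  (r.2, if r.1 = n then !r.2 else r.2)

/-- Replaces the random bit by the first bit received by database `n`. -/
def relabel (k n : Fin (M + 1)) (r : Fin (M + 1) × Bool) : Fin (M + 1) × Bool :=
  (r.1, selectionBit k r (n - k).val)

lemma relabel_involutive (k n : Fin (M + 1)) : Function.Involutive (relabel k n) := by
  rintro ⟨t, x⟩
  by_cases h : (n - k).val ≤ (t - k).val <;> simp [relabel, selectionBit, h]

/-- The source of privacy: `k` enters only through `relabel`, an involution, which preserves the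
uniform law. -/
lemma cyclicQuery_eq (k n : Fin (M + 1)) (r : Fin (M + 1) × Bool) :
    cyclicQuery k n r = localQuery n (relabel k n r) := by
  obtain ⟨t, x⟩ := r
  have hiff : t = n ↔ (t - k).val = (n - k).val := by
    rw [Fin.val_inj, sub_left_inj]
  refine Prod.ext rfl ?_
  simp only [cyclicQuery, localQuery, relabel, selectionBit, hiff]
  rcases lt_trichotomy (n - k).val (t - k).val with h | h | h
  · simp [h.le, Nat.succ_le_of_lt h, h.ne']
  · simp [h]
  · simp [h.not_ge, h.ne, (Nat.lt_succ_of_lt h).not_ge]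

lemma selectionBit_finRotate {k n : Fin (M + 1)} (h : finRotate (M + 1) n ≠ k)
    (r : Fin (M + 1) × Bool) :
    selectionBit k r (finRotate (M + 1) n - k).val = selectionBit k r ((n - k).val + 1) := by
  congr 1
  rw [finRotate_apply] at h ⊢
  have hadd : n + 1 - k = n - k + 1 := by abel
  rw [hadd, Fin.val_add_one, if_neg]
  intro hlast
  refine h (sub_eq_zero.1 ?_)
  rw [hadd, hlast, Fin.last_add_one]

/-- On return to `k` the position is `M + 1`, beyond every possible flip position. -/
lemma selectionBit_of_finRotate_eq {k n : Fin (M + 1)} (h : finRotate (M + 1) n = k)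
    (r : Fin (M + 1) × Bool) : selectionBit k r ((n - k).val + 1) = !r.2 := by
  rw [finRotate_apply] at h
  have hlast : n - k = Fin.last M := by
    rw [← h, ← sub_sub, sub_self, zero_sub, eq_comm, eq_neg_iff_add_eq_zero, Fin.last_add_one]
  have : ¬ M + 1 ≤ (r.1 - k).val := by have := (r.1 - k).isLt; omega
  simp [selectionBit, hlast, this]

/-- The answer of database `n`: the difference of the selected ones of its two messages. -/
def cyclicAnswer (n : Fin (M + 1)) (b : Bool × Bool)
    (z : cyclicStorage (M + 1) n → Fin L → F) : Fin L → F :=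
  (if b.1 then z ⟨n, Finset.mem_insert_self _ _⟩ else 0) -
    if b.2 then z ⟨finRotate (M + 1) n, Finset.mem_insert_of_mem (Finset.mem_singleton_self _)⟩
      else 0

/-- A message other than `w k` is selected by the same bit at both its databases, with opposite
signs, and cancels. For `w k` the two bits differ, so exactly one copy survives. -/
lemma sum_cyclicAnswer (k : Fin (M + 1)) (r : Fin (M + 1) × Bool)
    (w : Fin (M + 1) → Fin L → F) :
    ∑ n, cyclicAnswer n (cyclicQuery k n r) (fun m => w m) = if r.2 then w k else - w k := by
  have hdef : ∀ n, cyclicAnswer n (cyclicQuery k n r) (fun m => w m) =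
      (if selectionBit k r (n - k).val = true then w n else 0) -
        if selectionBit k r ((n - k).val + 1) = true then w (finRotate (M + 1) n) else 0 :=
    fun n => rfl
  rw [Finset.sum_congr rfl fun n _ => hdef n, Finset.sum_sub_distrib, ← Equiv.sum_comp (finRotate (M + 1)) fun n =>
    if selectionBit k r (n - k).val = true then w n else 0, ← Finset.sum_sub_distrib,
    Finset.sum_eq_single ((finRotate (M + 1)).symm k)]
  · rw [selectionBit_of_finRotate_eq ((finRotate (M + 1)).apply_symm_apply k),
      Equiv.apply_symm_apply]
    cases h : r.2 <;> simp [selectionBit, h]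
  · intro n _ hn
    rw [selectionBit_finRotate, sub_self]
    rintro rfl
    exact hn (Equiv.symm_apply_apply _ _).symm
  · simp

variable [Fintype F] [MeasurableSpace F] [DiscreteMeasurableSpace F]

variable (F M L) in
/-- Each message is a single block of `L` symbols. Going around the cycle from message `k`, all
databases are asked with equal selection bits, except for a uniformly random one. -/
noncomputable def cyclicScheme : PIRScheme F (cyclicStorage (M + 1)) L where
  Ω := (Fin (M + 1) → Fin L → F) × (Fin (M + 1) × Bool)
  P := (uniformOn Set.univ).prod (uniformOn Set.univ)
  Query _ := Bool × Bool
  Answer _ := Fin L → F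
  W := Prod.fst
  Q k n ω := cyclicQuery k n ω.2
  A k n ω := cyclicAnswer n (cyclicQuery k n ω.2) (fun m => ω.1 m)
  measurable_W := measurable_fst
  measurable_Q _ _ := .of_discrete
  measurable_A _ _ := .of_discrete
  uniform_W w := by
    have : (Prod.fst ⁻¹' {w} : Set ((Fin (M + 1) → Fin L → F) × (Fin (M + 1) × Bool))) =
        {w} ×ˢ Set.univ := by
      ext; simp
    rw [this, Measure.prod_prod, measure_univ, mul_one, uniformOn_univ, Measure.count_singleton]
    simp [← pow_mul, mul_comm L]
  indep k := indepFun_prod (X := id) (Y := fun r n => cyclicQuery k n r) measurable_id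
    .of_discrete
  answer_deterministic k n :=
    ⟨fun x => cyclicAnswer n x.1 x.2, .of_discrete, .of_forall fun _ => rfl⟩

lemma cyclicScheme_isPrivate : (cyclicScheme F M L).IsPrivate := by
  intro n
  have key : ∀ k, (cyclicScheme F M L).P.map (fun ω => ((cyclicScheme F M L).Q k n ω,
      (cyclicScheme F M L).A k n ω, (cyclicScheme F M L).W ω)) =
      ((uniformOn Set.univ).prod (uniformOn Set.univ) :
        Measure ((Fin (M + 1) → Fin L → F) × (Fin (M + 1) × Bool))).map
        fun ω => (localQuery n ω.2, cyclicAnswer n (localQuery n ω.2) (fun m => ω.1 m), ω.1) := by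
    intro k
    have hinv : ((uniformOn Set.univ).prod (uniformOn Set.univ) :
        Measure ((Fin (M + 1) → Fin L → F) × (Fin (M + 1) × Bool))).map
        (Prod.map id (relabel k n)) = (uniformOn Set.univ).prod (uniformOn Set.univ) := by
      rw [← Measure.map_prod_map _ _ measurable_id .of_discrete, Measure.map_id,
        map_uniformOn_univ_of_involutive (relabel_involutive k n)]
    conv_rhs => rw [← hinv, Measure.map_map .of_discrete .of_discrete]
    simp only [cyclicScheme, cyclicQuery_eq]
    rfl
  intro i j
  rw [key i, key j]

lemma cyclicScheme_isReliable : (cyclicScheme F M L).IsReliable := by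
  intro k
  refine ⟨fun x => if (show Bool × Bool from x.1 k).1 then
    ∑ n, (show Fin L → F from x.2 n) else -∑ n, (show Fin L → F from x.2 n), ?_,
    .of_forall fun ω => ?_⟩
  · exact Measurable.of_discrete (α := (Fin (M + 1) → Bool × Bool) × (Fin (M + 1) → Fin L → F))
  · have h := sum_cyclicAnswer k ω.2 ω.1
    have hbit : (cyclicQuery k k ω.2).1 = ω.2.2 := by simp [cyclicQuery, selectionBit]
    change (if (cyclicQuery k k ω.2).1 = true then
      ∑ n, cyclicAnswer n (cyclicQuery k n ω.2) (fun m => ω.1 m) else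
      -∑ n, cyclicAnswer n (cyclicQuery k n ω.2) (fun m => ω.1 m)) = ω.1 k
    rw [h, hbit]
    cases ω.2.2 <;> simp

lemma cyclicScheme_measureReal_answer_ne_zero_le (k n : Fin (M + 1)) :
    (cyclicScheme F M L).P.real {ω | (cyclicScheme F M L).A k n ω ≠ (0 : Fin L → F)} ≤
      ((M + 1 : ℕ) + 1 : ℝ) / (2 * (M + 1 : ℕ)) := by
  set T : Set (Fin (M + 1) × Bool) := {r | localQuery n r ≠ (false, false)} with hT
  have hsub : {ω | (cyclicScheme F M L).A k n ω ≠ (0 : Fin L → F)} ⊆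
      (Set.univ ×ˢ (relabel k n ⁻¹' T) : Set ((Fin (M + 1) → Fin L → F) × _)) := by
    rintro ω hω
    refine ⟨trivial, fun h => hω ?_⟩
    rw [← cyclicQuery_eq] at h
    change cyclicAnswer n (cyclicQuery k n ω.2) (fun m => ω.1 m) = 0
    simp [h, cyclicAnswer]
  -- Out of `2 * (M + 1)` outcomes: all those with bit `true`, and the flip at `n` with bit `false`.
  have hcount : T.ncard ≤ M + 1 + 1 := by
    have hsub : T ⊆ insert (n, false) ((fun t => (t, true)) '' Set.univ) := by
      rintro ⟨t, x⟩ h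
      cases x
      · by_cases htn : t = n
        · simp [htn]
        · exact absurd (by simp [localQuery, htn]) h
      · simp
    refine (Set.ncard_le_ncard hsub).trans ((Set.ncard_insert_le _ _).trans ?_)
    gcongr
    refine (Set.ncard_image_le Set.finite_univ).trans ?_
    simp [Set.ncard_univ]
  calc _ ≤ ((uniformOn Set.univ).prod (uniformOn Set.univ) :
        Measure ((Fin (M + 1) → Fin L → F) × (Fin (M + 1) × Bool))).real
          (Set.univ ×ˢ (relabel k n ⁻¹' T)) := measureReal_mono hsub
    _ = (uniformOn (Set.univ : Set (Fin (M + 1) × Bool))).real T := by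
      rw [measureReal_prod_prod, probReal_univ, one_mul,
        ← map_measureReal_apply .of_discrete .of_discrete,
        map_uniformOn_univ_of_involutive (relabel_involutive k n)]
    _ = T.ncard / (2 * (M + 1 : ℕ)) := by
      rw [measureReal_def, uniformOn_univ, Measure.count_apply .of_discrete,
        ENNReal.toReal_div, ← T.toFinite.cast_ncard_eq, ENat.toENNReal_coe,
        ENNReal.toReal_natCast, ENNReal.toReal_natCast]
      simp [mul_comm]
    _ ≤ _ := by
      gcongr
      exact_mod_cast hcount

lemma cyclicScheme_sum_shannonEntropy_le (k : Fin (M + 1)) :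
    ∑ n, shannonEntropy (Fintype.card F) (cyclicScheme F M L).P ((cyclicScheme F M L).A k n) ≤
      ENNReal.ofReal (((M + 1 : ℕ) + 1 : ℝ) / 2 * L +
        2 * (M + 1 : ℕ) / Real.log (Fintype.card F)) := by
  have hq : 1 < Fintype.card F := Fintype.one_lt_card
  have hlog : 0 < Real.log (Fintype.card F) := Real.log_pos (by exact_mod_cast hq)
  have hbound : ∀ n, shannonEntropy (Fintype.card F) (cyclicScheme F M L).P
      ((cyclicScheme F M L).A k n) ≤ ENNReal.ofReal
        ((((M + 1 : ℕ) + 1 : ℝ) / (2 * (M + 1 : ℕ)) * (L * Real.log (Fintype.card F)) + 2) /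
          Real.log (Fintype.card F)) := by
    intro n
    have h := shannonEntropy_le_of_fintype hq ((uniformOn Set.univ).prod (uniformOn Set.univ) :
      Measure ((Fin (M + 1) → Fin L → F) × (Fin (M + 1) × Bool)))
      (X := fun ω => cyclicAnswer n (cyclicQuery k n ω.2) fun m => ω.1 m) .of_discrete 0
    refine h.trans (ENNReal.ofReal_le_ofReal ?_)
    have hcard : Real.log (Fintype.card (Fin L → F)) = L * Real.log (Fintype.card F) := by simp
    rw [hcard]
    gcongr
    exact cyclicScheme_measureReal_answer_ne_zero_le k n
  refine (Finset.sum_le_sum fun n _ => hbound n).trans ?_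
  rw [Finset.sum_const, nsmul_eq_mul, Finset.card_univ, Fintype.card_fin,
    ← ENNReal.ofReal_natCast, ← ENNReal.ofReal_mul (Nat.cast_nonneg _)]
  refine ENNReal.ofReal_le_ofReal (le_of_eq ?_)
  have : ((M + 1 : ℕ) : ℝ) ≠ 0 := by positivity
  field_simp

lemma ofReal_le_cyclicScheme_rate (hL : 0 < L) (k : Fin (M + 1)) :
    ENNReal.ofReal (L / (((M + 1 : ℕ) + 1 : ℝ) / 2 * L +
      2 * (M + 1 : ℕ) / Real.log (Fintype.card F))) ≤ (cyclicScheme F M L).rate k := by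
  have hlog : 0 < Real.log (Fintype.card F) :=
    Real.log_pos (by exact_mod_cast (Fintype.one_lt_card : 1 < Fintype.card F))
  rw [ENNReal.ofReal_div_of_pos (by positivity), ENNReal.ofReal_natCast]
  exact ENNReal.div_le_div_left (cyclicScheme_sum_shannonEntropy_le k) _

variable (F M) in
-- The overhead `2 * (M + 1) / log |F|` does not grow with `L`, so it disappears from the rate bound
-- in the limit.
lemma two_div_le_pirCapacity_cyclicStorage :
    2 / (((M + 1 : ℕ) : ℝ≥0∞) + 1) ≤ pirCapacity F (cyclicStorage (M + 1)) := by
  have hlim : Filter.Tendsto (fun L : ℕ => ENNReal.ofReal (L / (((M + 1 : ℕ) + 1 : ℝ) / 2 * L +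
      2 * (M + 1 : ℕ) / Real.log (Fintype.card F)))) Filter.atTop
      (nhds (ENNReal.ofReal (2 / ((M + 1 : ℕ) + 1 : ℝ)))) := by
    refine ENNReal.tendsto_ofReal ?_
    have h0 := tendsto_const_div_atTop_nhds_zero_nat (2 * (M + 1 : ℕ) / Real.log (Fintype.card F))
    have h1 := (h0.const_add (((M + 1 : ℕ) + 1 : ℝ) / 2)).inv₀ (by positivity)
    rw [add_zero, inv_div] at h1
    refine h1.congr' ?_
    filter_upwards [Filter.eventually_gt_atTop 0] with L hL
    have hL' : (L : ℝ) ≠ 0 := by positivity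
    rw [← inv_div (_ + _) (L : ℝ), add_div (_ * _), mul_div_cancel_right₀ _ hL']
  have hval : ENNReal.ofReal (2 / ((M + 1 : ℕ) + 1 : ℝ)) = 2 / (((M + 1 : ℕ) : ℝ≥0∞) + 1) := by
    rw [ENNReal.ofReal_div_of_pos (by positivity),
      ENNReal.ofReal_add (by positivity) zero_le_one, ENNReal.ofReal_natCast]
    simp
  rw [← hval]
  refine le_of_tendsto hlim ?_
  filter_upwards [Filter.eventually_gt_atTop 0] with L hL
  exact (ofReal_le_cyclicScheme_rate hL 0).trans (le_sSup ⟨L, hL, cyclicScheme F M L,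
    cyclicScheme_isPrivate, cyclicScheme_isReliable, 0, rfl⟩)

end CyclicScheme

theorem theorem2 (F : Type) [Field F] [Fintype F] [MeasurableSpace F] [DiscreteMeasurableSpace F]
    (K : ℕ) (hK : 2 ≤ K) :
    pirCapacity F (cyclicStorage K) = 2 / ((K : ℝ≥0∞) + 1) := by
  refine le_antisymm (sSup_le ?_) ?_
  · rintro _ ⟨L, -, S, hpriv, hrel, k, rfl⟩
    exact PIRScheme.rate_le_of_isPrivate_of_isReliable hK hpriv hrel k
  · obtain ⟨M, rfl⟩ : ∃ M, K = M + 1 := ⟨K - 1, by omega⟩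
    exact two_div_le_pirCapacity_cyclicStorage F M
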